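/- Let $n,m\ge 0$ be integers and let $\theta:\mathbb R^m\to(-\infty,\infty]$ be convex piecewise linear, i.e. its epigraph is a convex polyhedron in $\mathbb R^{m+1}$. Let $f:\mathbb R^n\to\mathbb R^n$ and $\Phi:\mathbb R^n\to\mathbb R^m$, with $\Phi$ differentiable on $\mathbb R^n$, and put $$\Psi(x,v):=f(x)+\nabla\Phi(x)^*v .$$ Let $\partial\theta$ be the subdifferential of convex analysis (empty outside $\{z:\theta(z)<\infty\}$), $\theta^*$ the Fenchel conjugate, $\Lambda(\bar x):=\{v:\Psi(\bar x,v)=0,\ v\in\partial\theta(\Phi(\bar x))\}$, and let $$S(p_1,p_2):=\{(x,v)\in\mathbb R^n\times\mathbb R^m:\ p_1=\Psi(x,v),\ p_2\in-\Phi(x)+(\partial\theta)^{-1}(v)\}$$ be the solution map of the canonically perturbed system. Suppose $(\bar x,\bar v)\in S(0,0)$ (equivalently $\bar v\in\Lambda(\bar x)$), that $f$ is differentiable at $\bar x$, and that $\nabla\Phi$ is differentiable at $\bar x$. For $(\bar z,\bar v)\in\operatorname{gph}\partial\theta$ let $(D\partial\theta)(\bar z,\bar v)(u)$ be the set of all $w\in\mathbb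 R^m$ such that $(u,w)$ belongs to the Bouligand tangent cone to $\operatorname{gph}\partial\theta$ at $(\bar z,\bar v)$, i.e. $(u,w)=\lim_k\alpha_k(q_k-(\bar z,\bar v))$ for some $\alpha_k\ge0$ and $q_k\in\operatorname{gph}\partial\theta$ with $q_k\to(\bar z,\bar v)$. The multiplier $\bar v$ is called critical if there is $\xi\in\mathbb R^n$, $\xi\neq0$, with $$0\in\nabla_x\Psi(\bar x,\bar v)\xi+\nabla\Phi(\bar x)^*(D\partial\theta)(\Phi(\bar x),\bar v)\big(\nabla\Phi(\bar x)\xi\big),$$ and noncritical otherwise. Then the following are equivalent, where norms are Euclidean, $\mathbb B_\varepsilon$ denotes closed balls, and $\operatorname{dist}(\cdot\,;\emptyset)=\infty$. **(i)** $\bar v$ is noncritical. **(ii)** (Semi-isolated calmness.) There are $\varepsilon>0$, $\ell\ge0$ and neighborhoods $U$ of $0\in\mathbb R^n$ and $W$ of $0\in\mathbb R^m$ such that for all $(p_1,p_2)\in U\times W$ and all $(x,v)\in S(p_1,p_2)\cap\mathbb B_\varepsilon(\bar x,\bar v)$, $$\|x-\bar x\|+\operatorname{dist}(v;\Lambda(\bar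 x))\le\ell\,(\|p_1\|+\|p_2\|).$$ **(iii)** (Error bound.) There are $\varepsilon>0$ and $\ell\ge0$ such that for all $(x,v)\in\mathbb B_\varepsilon(\bar x,\bar v)$, $$\|x-\bar x\|+\operatorname{dist}(v;\Lambda(\bar x))\le\ell\,\big(\|\Psi(x,v)\|+\operatorname{dist}(\Phi(x);\partial\theta^*(v))\big).$$ -/

import Mathlib

open Filter Topology Set

noncomputable section

namespace VarSys

section General

variable {X Y : Type*} [NormedAddCommGroup X] [NormedSpace ℝ X]
  [NormedAddCommGroup Y] [NormedSpace ℝ Y]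

/-- A convex polyhedron: the intersection of finitely many closed half-spaces. -/
def IsPolyhedron (C : Set X) : Prop :=
  ∃ (k : ℕ) (φ : Fin k → (X →L[ℝ] ℝ)) (b : Fin k → ℝ), C = {x | ∀ i, φ i x ≤ b i}

/-- The Bouligand-Severi tangent cone `T(z; Ω)`, for `z ∈ Ω`. -/
def bouligandCone (Ω : Set X) (z : X) : Set X :=
  {w | ∃ (y : ℕ → X) (α : ℕ → ℝ), (∀ k, y k ∈ Ω) ∧ (∀ k, 0 ≤ α k) ∧
    Tendsto y atTop (𝓝 z) ∧ Tendsto (fun k => α k • (y k - z)) atTop (𝓝 w)}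

/-- The graph of a set-valued mapping. -/
def gph (F : X → Set Y) : Set (X × Y) := {q | q.2 ∈ F q.1}

/-- The graphical derivative `DF(x, y)(u)` of a set-valued mapping at `(x, y) ∈ gph F`. -/
def graphicalDeriv (F : X → Set Y) (x : X) (y : Y) (u : X) : Set Y :=
  {w | (u, w) ∈ bouligandCone (gph F) (x, y)}

/-- `θ` takes values in `(-∞, ∞]` and its epigraph `{(z, r) : θ z ≤ r}` is a convex polyhedron. -/
def IsCPWL (θ : X → EReal) : Prop :=
  (∀ z, θ z ≠ ⊥) ∧ IsPolyhedron {q : X × ℝ | θ q.1 ≤ (q.2 : EReal)}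

end General

section Euclidean

variable {E F : Type*} [NormedAddCommGroup E] [InnerProductSpace ℝ E] [CompleteSpace E]
  [NormedAddCommGroup F] [InnerProductSpace ℝ F] [CompleteSpace F]

/-- The subdifferential of convex analysis; it is empty where `θ` is not finite. -/
def subdiff (θ : F → EReal) (z : F) : Set F :=
  {v | θ z ≠ ⊤ ∧ θ z ≠ ⊥ ∧ ∀ w, θ z + ((inner ℝ v (w - z) : ℝ) : EReal) ≤ θ w}

/-- The Fenchel conjugate `θ*(v) = sup_z (⟨v, z⟩ - θ(z))`. -/
def fenchelConj (θ : F → EReal) (v : F) : EReal :=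
  ⨆ z, (((inner ℝ v z : ℝ) : EReal) - θ z)

/-- `Ψ(x, v) = f(x) + ∇Φ(x)* v`. -/
def Psi (f : E → E) (Φ : E → F) (x : E) (v : F) : E :=
  f x + ContinuousLinearMap.adjoint (fderiv ℝ Φ x) v

/-- The set `Λ(x) = {v : Ψ(x, v) = 0, v ∈ ∂θ(Φ(x))}` of Lagrange multipliers. -/
def multipliers (f : E → E) (Φ : E → F) (θ : F → EReal) (x : E) : Set F :=
  {v | Psi f Φ x v = 0 ∧ v ∈ subdiff θ (Φ x)}

/-- The multiplier `v` is critical: `0 ∈ ∇ₓΨ(x, v) ξ + ∇Φ(x)* (D∂θ)(Φ(x), v)(∇Φ(x) ξ)`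
for some `ξ ≠ 0`. -/
def IsCritical (f : E → E) (Φ : E → F) (θ : F → EReal) (x : E) (v : F) : Prop :=
  ∃ ξ : E, ξ ≠ 0 ∧ ∃ η ∈ graphicalDeriv (subdiff θ) (Φ x) v (fderiv ℝ Φ x ξ),
    fderiv ℝ (fun x' => Psi f Φ x' v) x ξ + ContinuousLinearMap.adjoint (fderiv ℝ Φ x) η = 0

/-- The set-valued mapping `G(x, v) = (Ψ(x, v), -Φ(x)) + {0} × (∂θ)⁻¹(v)`. -/
def genEq (f : E → E) (Φ : E → F) (θ : F → EReal) (x : E) (v : F) : Set (E × F) :=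
  {p | p.1 = Psi f Φ x v ∧ ∃ z, v ∈ subdiff θ z ∧ p.2 = -Φ x + z}

/-- The solution map `S = G⁻¹` of the canonically perturbed system. -/
def solMap (f : E → E) (Φ : E → F) (θ : F → EReal) (p₁ : E) (p₂ : F) : Set (E × F) :=
  {q | (p₁, p₂) ∈ genEq f Φ θ q.1 q.2}

/-- Semi-isolated calmness of the solution map at `((0, 0), (xb, vb))`. -/
def SemiIsolatedCalm (f : E → E) (Φ : E → F) (θ : F → EReal) (xb : E) (vb : F) : Prop :=
  ∃ ε : ℝ, 0 < ε ∧ ∃ ℓ : ℝ, 0 ≤ ℓ ∧ ∃ U ∈ 𝓝 (0 : E), ∃ W ∈ 𝓝 (0 : F),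
    ∀ p₁ ∈ U, ∀ p₂ ∈ W, ∀ x v, (x, v) ∈ solMap f Φ θ p₁ p₂ ∩ Metric.closedBall (xb, vb) ε →
      ‖x - xb‖ + Metric.infDist v (multipliers f Φ θ xb) ≤ ℓ * (‖p₁‖ + ‖p₂‖)

/-- The local error bound at `(xb, vb)`. Distances are taken in `[0, ∞]`, so that the distance
to an empty set is `∞`, and the estimate is void where `∂θ*(v)` is empty. -/
def ErrorBound (f : E → E) (Φ : E → F) (θ : F → EReal) (xb : E) (vb : F) : Prop :=
  ∃ ε : ℝ, 0 < ε ∧ ∃ ℓ : NNReal, ∀ x v, (x, v) ∈ Metric.closedBall (xb, vb) ε →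
    ‖x - xb‖ₑ + Metric.infEDist v (multipliers f Φ θ xb) ≤
      ℓ * (‖Psi f Φ x v‖ₑ + Metric.infEDist (Φ x) (subdiff (fenchelConj θ) v))

end Euclidean

end VarSys

end

/-! The heart is (i) ⇒ (ii), by contradiction. If calmness fails, perturbed solutions (x_k, v_k)
tend to (x̄, v̄) with residuals negligible against ‖x_k - x̄‖ + dist(v_k; Λ). Since ∂θ takes only
finitely many values, one per set of active epigraph constraints, a subsequence of the v_k lies in
one polyhedral face Q that contains v̄ and is contained in ∂θ at all base points and at their limit
(`IsCPWL.exists_subseq_face`).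

Hoffman's lemma on Q (from `exists_conformal_norm_le`) then does two jobs. It bounds dist(v_k; Λ) by
a multiple of ‖∇Φ(x̄)*(v_k - v̄)‖, so that the residuals are in fact o(‖x_k - x̄‖). It also replaces
v_k by v'_k ∈ Q with the same image under ∇Φ(x̄)* and ‖v'_k - v̄‖ = O(‖x_k - x̄‖); the difference
quotients then subconverge to a pair (ξ, η) with ‖ξ‖ = 1 that witnesses criticality
(`isCritical_of_tendsto`).

Conversely, a critical ξ yields perturbed solutions along x̄ + tξ with residual o(t), against (ii).
The equivalence of (ii) and (iii) rests on ∂θ* = (∂θ)⁻¹. -/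

namespace VarSys

/-! ### Hoffman's lemma and Farkas' lemma for finitely generated cones. -/

section Hoffman

variable {ι Y : Type*} [NormedAddCommGroup Y] [NormedSpace ℝ Y]

/-- The closed cone of vectors that are nonpositive off `P` and nonnegative off `N`. -/
def signCone (N P : Finset ι) : Set (ι → ℝ) :=
  {e | (∀ i, i ∉ P → e i ≤ 0) ∧ ∀ i, i ∉ N → 0 ≤ e i}

theorem isClosed_signCone (N P : Finset ι) : IsClosed (signCone N P) := by
  simp only [signCone, ofPred_and, ofPred_forall]
  refine IsClosed.inter ?_ ?_
  · exact isClosed_iInter fun i => isClosed_iInter fun _ =>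
      isClosed_le (continuous_apply i) continuous_const
  · exact isClosed_iInter fun i => isClosed_iInter fun _ =>
      isClosed_le continuous_const (continuous_apply i)

theorem smul_mem_signCone {N P : Finset ι} {e : ι → ℝ} (he : e ∈ signCone N P) {t : ℝ}
    (ht : 0 ≤ t) : t • e ∈ signCone N P :=
  ⟨fun i hi => mul_nonpos_of_nonneg_of_nonpos ht (he.1 i hi),
    fun i hi => mul_nonneg ht (he.2 i hi)⟩

variable [Fintype ι]

/-- A linear map with trivial kernel on a closed sign cone is bounded below on it. -/
theorem exists_norm_le_of_mem_signCone (B : (ι → ℝ) →ₗ[ℝ] Y) (N P : Finset ι) :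
    ∃ c : ℝ, 0 ≤ c ∧ ((∀ e ∈ signCone N P, B e = 0 → e = 0) →
      ∀ e ∈ signCone N P, ‖e‖ ≤ c * ‖B e‖) := by
  by_cases hker : ∀ e ∈ signCone N P, B e = 0 → e = 0
  swap
  -- The constant precedes the kernel hypothesis so that one can be chosen for every sign pattern;
  -- here the claim is vacuous and 0 is a dummy.
  · exact ⟨0, le_rfl, fun h => absurd h hker⟩
  have hK : IsCompact (Metric.sphere (0 : ι → ℝ) 1 ∩ signCone N P) :=
    (isCompact_sphere _ _).inter_right (isClosed_signCone N P)
  have hnorm : ∀ e ∈ signCone N P, e ≠ 0 →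
      ‖e‖⁻¹ • e ∈ Metric.sphere (0 : ι → ℝ) 1 ∩ signCone N P := by
    intro e he h0
    refine ⟨?_, smul_mem_signCone he (by positivity)⟩
    rw [mem_sphere_zero_iff_norm, norm_smul, norm_inv, norm_norm,
      inv_mul_cancel₀ (norm_ne_zero_iff.2 h0)]
  rcases (Metric.sphere (0 : ι → ℝ) 1 ∩ signCone N P).eq_empty_or_nonempty with hE | hE
  · refine ⟨0, le_rfl, fun _ e he => ?_⟩
    by_cases h0 : e = 0
    · simp [h0]
    · exact absurd (hnorm e he h0) (by simp [hE])
  · obtain ⟨e₀, he₀, hmin⟩ := hK.exists_isMinOn hE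
      ((B.continuous_of_finiteDimensional).norm.continuousOn)
    have hne : e₀ ≠ 0 := by
      rintro rfl
      simpa using he₀.1
    have hpos : 0 < ‖B e₀‖ := norm_pos_iff.2 fun h => hne (hker _ he₀.2 h)
    refine ⟨‖B e₀‖⁻¹, by positivity, fun _ e he => ?_⟩
    by_cases h0 : e = 0
    · simp [h0]
    · have h1 : ‖B e₀‖ ≤ ‖B (‖e‖⁻¹ • e)‖ := hmin (hnorm e he h0)
      have h2 : 0 < ‖e‖ := norm_pos_iff.2 h0
      rw [map_smul, norm_smul, norm_inv, norm_norm, inv_mul_eq_div, le_div_iff₀ h2] at h1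
      rw [inv_mul_eq_div, le_div_iff₀ hpos]
      linarith

/-- Every vector can be shrunk coordinatewise, without changing its image under a linear map, to
one whose norm is controlled by that of the image. -/
theorem exists_conformal_norm_le (B : (ι → ℝ) →ₗ[ℝ] Y) :
    ∃ c : ℝ, 0 ≤ c ∧ ∀ d : ι → ℝ, ∃ d' ∈ Icc (0 ⊓ d) (0 ⊔ d), B d' = B d ∧
      ‖d'‖ ≤ c * ‖B d‖ := by
  choose c hc0 hc using exists_norm_le_of_mem_signCone B
  -- There are finitely many sign patterns; the sum dominates each of their constants.
  refine ⟨∑ N, ∑ P, c N P, Finset.sum_nonneg fun N _ => Finset.sum_nonneg fun P _ => hc0 N P,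
    fun d => ?_⟩
  have hBc : Continuous B := B.continuous_of_finiteDimensional
  have hK : IsCompact (Icc (0 ⊓ d) (0 ⊔ d) ∩ {e | B e = B d}) :=
    isCompact_Icc.inter_right (isClosed_eq hBc continuous_const)
  -- Take the vector of least ℓ¹ norm in the box with the prescribed image.
  obtain ⟨d', ⟨hd', hBd⟩, hmin⟩ := hK.exists_isMinOn (f := fun e : ι → ℝ => ∑ i, |e i|)
    ⟨d, ⟨inf_le_right, le_sup_right⟩, rfl⟩ (by fun_prop)
  refine ⟨d', hd', hBd, ?_⟩
  classical
  set N : Finset ι := {i | d' i < 0}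
  set P : Finset ι := {i | 0 < d' i}
  -- A nonzero kernel vector with signs compatible with `d'` could be subtracted in a small
  -- multiple, staying in the box and lowering the ℓ¹ norm.
  have hker : ∀ e ∈ signCone N P, B e = 0 → e = 0 := by
    intro e he hBe
    by_contra hne
    have hev : ∀ᶠ t : ℝ in 𝓝[>] 0, ∀ i, d' i ≠ 0 → t * |e i| ≤ |d' i| := by
      rw [eventually_all]
      intro i
      by_cases hi : d' i = 0
      · simp [hi]
      · have : Tendsto (fun t : ℝ => t * |e i|) (𝓝[>] 0) (𝓝 (0 * |e i|)) :=
          ((continuous_id.mul continuous_const).tendsto 0).mono_left nhdsWithin_le_nhds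
        rw [zero_mul] at this
        filter_upwards [this.eventually_lt_const (abs_pos.2 hi)] with t ht _ using ht.le
    obtain ⟨t, ht, htpos⟩ := (hev.and self_mem_nhdsWithin).exists
    have htpos : 0 < t := htpos
    have key : ∀ i, (min 0 (d i) ≤ d' i - t * e i ∧ d' i - t * e i ≤ max 0 (d i)) ∧
        |d' i - t * e i| = |d' i| - t * |e i| := by
      intro i
      have h1 : min 0 (d i) ≤ d' i := hd'.1 i
      have h2 : d' i ≤ max 0 (d i) := hd'.2 i
      have h3 : min 0 (d i) ≤ 0 := min_le_left _ _
      have h4 : 0 ≤ max 0 (d i) := le_max_left _ _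
      rcases lt_trichotomy (d' i) 0 with h | h | h
      · have he0 : e i ≤ 0 := he.1 i (by simp [P, h.le])
        have h5 := ht i h.ne
        rw [abs_of_nonpos he0, abs_of_neg h] at h5
        have h6 : t * e i ≤ 0 := mul_nonpos_of_nonneg_of_nonpos htpos.le he0
        rw [abs_of_nonpos he0, abs_of_neg h, abs_of_nonpos (by linarith)]
        exact ⟨⟨by linarith, by linarith⟩, by ring⟩
      · have he0 : e i = 0 :=
          le_antisymm (he.1 i (by simp [P, h])) (he.2 i (by simp [N, h]))
        simp [he0, h]
      · have he0 : 0 ≤ e i := he.2 i (by simp [N, h.le])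
        have h5 := ht i h.ne'
        rw [abs_of_nonneg he0, abs_of_pos h] at h5
        have h6 : 0 ≤ t * e i := mul_nonneg htpos.le he0
        rw [abs_of_nonneg he0, abs_of_pos h, abs_of_nonneg (by linarith)]
        exact ⟨⟨by linarith, by linarith⟩, rfl⟩
    have hle : ∑ i, |d' i| ≤ ∑ i, |(d' - t • e) i| :=
      hmin ⟨⟨fun i => (key i).1.1, fun i => (key i).1.2⟩, by
        simp only [mem_ofPred_eq] at hBd ⊢
        simp [hBe, hBd]⟩
    have hsum : ∑ i, |(d' - t • e) i| = ∑ i, |d' i| - t * ∑ i, |e i| := by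
      rw [Finset.mul_sum, ← Finset.sum_sub_distrib]
      exact Finset.sum_congr rfl fun i _ => (key i).2
    obtain ⟨j, hj⟩ := Function.ne_iff.1 hne
    have : 0 < ∑ i, |e i| :=
      Finset.sum_pos' (fun i _ => abs_nonneg _) ⟨j, Finset.mem_univ j, abs_pos.2 hj⟩
    have := mul_pos htpos this
    linarith
  have hmem : d' ∈ signCone N P :=
    ⟨fun i hi => by simpa [P] using hi, fun i hi => by simpa [N] using hi⟩
  have h1 := hc N P hker d' hmem
  have h2 : c N P ≤ ∑ N, ∑ P, c N P :=
    (Finset.single_le_sum (f := fun P => c N P) (fun P _ => hc0 N P) (Finset.mem_univ P)).trans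
      (Finset.single_le_sum (f := fun N => ∑ P, c N P)
        (fun N _ => Finset.sum_nonneg fun P _ => hc0 N P) (Finset.mem_univ N))
  have h3 : B d' = B d := hBd
  rw [h3] at h1
  exact h1.trans (mul_le_mul_of_nonneg_right h2 (norm_nonneg _))

/-- Hoffman's lemma for the polyhedra `{μ ≥ 0 : B μ = b}`, uniformly in `b`. -/
theorem exists_hoffman (B : (ι → ℝ) →ₗ[ℝ] Y) :
    ∃ c : ℝ, 0 ≤ c ∧ ∀ s t : ι → ℝ, 0 ≤ s → 0 ≤ t →
      ∃ s' : ι → ℝ, 0 ≤ s' ∧ B s' = B t ∧ ‖s' - s‖ ≤ c * ‖B t - B s‖ := by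
  obtain ⟨c, hc, h⟩ := exists_conformal_norm_le B
  refine ⟨c, hc, fun s t hs ht => ?_⟩
  -- Each coordinate of `s + d` lies between those of `s` and `t`, hence is nonnegative.
  obtain ⟨d, hd, hB, hn⟩ := h (t - s)
  refine ⟨s + d, fun i => ?_, by simp [hB], by simpa using hn⟩
  have h1 : min 0 (t i - s i) ≤ d i := hd.1 i
  have h2 : 0 ≤ s i := hs i
  have h3 : 0 ≤ t i := ht i
  show 0 ≤ s i + d i
  rcases min_le_iff.1 h1 with h | h <;> linarith

/-- A linear map sends the nonnegative orthant to a closed set. -/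
theorem isClosed_image_nonneg (B : (ι → ℝ) →ₗ[ℝ] Y) : IsClosed (B '' {s | 0 ≤ s}) := by
  obtain ⟨c, hc, h⟩ := exists_hoffman B
  refine IsSeqClosed.isClosed fun y y₀ hy hlim => ?_
  choose t ht hty using hy
  -- Hoffman's lemma at the base point 0 replaces the preimages by bounded ones.
  choose s hs hBs hn using fun k => h 0 (t k) le_rfl (ht k)
  obtain ⟨M, hM⟩ := hlim.norm.bddAbove_range
  have hbd : ∀ k, s k ∈ Metric.closedBall (0 : ι → ℝ) (c * M) := fun k => by
    rw [mem_closedBall_zero_iff]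
    have h1 := hn k
    rw [map_zero, sub_zero, sub_zero, hty] at h1
    exact h1.trans (mul_le_mul_of_nonneg_left (hM ⟨k, rfl⟩) hc)
  obtain ⟨s₀, -, φ, hφ, hs₀⟩ := (isCompact_closedBall _ _).tendsto_subseq hbd
  refine ⟨s₀, ge_of_tendsto' hs₀ fun k => hs _, ?_⟩
  have h1 := (B.continuous_of_finiteDimensional.tendsto s₀).comp hs₀
  refine tendsto_nhds_unique h1 ((hlim.comp hφ.tendsto_atTop).congr fun k => ?_)
  simp [hBs, hty]

/-- Farkas' lemma for a finitely generated cone. -/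
theorem exists_nonneg_of_forall_functional (B : (ι → ℝ) →ₗ[ℝ] Y) (y : Y)
    (h : ∀ l : Y →L[ℝ] ℝ, (∀ s, 0 ≤ s → l (B s) ≤ 0) → l y ≤ 0) : ∃ s, 0 ≤ s ∧ B s = y := by
  by_contra hy
  have hconv : Convex ℝ (B '' {s | 0 ≤ s}) := (convex_Ici (0 : ι → ℝ)).linear_image B
  obtain ⟨l, u, hl, hu⟩ := geometric_hahn_banach_closed_point hconv (isClosed_image_nonneg B)
    (fun ⟨s, hs, hB⟩ => hy ⟨s, hs, hB⟩ : y ∉ B '' {s | 0 ≤ s})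
  have hu0 : 0 < u := by simpa using hl 0 ⟨0, by simp, map_zero B⟩
  refine absurd (h l fun s hs => ?_) (by linarith)
  by_contra hpos
  push Not at hpos
  -- The scaling makes the functional equal to `u` on the cone, where it must stay strictly below
  -- `u`.
  have h1 := hl _ ⟨(u / l (B s)) • s, smul_nonneg (by positivity) hs, rfl⟩
  rw [map_smul, map_smul, smul_eq_mul, div_mul_cancel₀ _ hpos.ne'] at h1
  exact lt_irrefl _ h1

end Hoffman

end VarSys

namespace VarSys

/-! ### Faces of the subdifferential of a polyhedral function. -/

section Polyhedral

variable {F : Type*} [NormedAddCommGroup F] [InnerProductSpace ℝ F]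

/-- The common value of the subdifferential at all points of the graph at which the constraints
of the epigraph active at the point are those with index in `J`. -/
def faceSubdiff {k : ℕ} (φ : Fin k → (F × ℝ →L[ℝ] ℝ)) (J : Finset (Fin k)) : Set F :=
  {v | ∀ (h : F) (τ : ℝ), (∀ i ∈ J, φ i (h, τ) ≤ 0) → inner ℝ v h ≤ τ}

theorem faceSubdiff_mono {k : ℕ} (φ : Fin k → (F × ℝ →L[ℝ] ℝ)) {J J' : Finset (Fin k)}
    (hJ : J ⊆ J') : faceSubdiff φ J ⊆ faceSubdiff φ J' :=
  fun _ hv h τ hi => hv h τ fun i hiJ => hi i (hJ hiJ)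

theorem isClosed_faceSubdiff {k : ℕ} (φ : Fin k → (F × ℝ →L[ℝ] ℝ)) (J : Finset (Fin k)) :
    IsClosed (faceSubdiff φ J) := by
  simp only [faceSubdiff, ofPred_forall]
  exact isClosed_iInter fun h => isClosed_iInter fun τ => isClosed_iInter fun _ =>
    isClosed_le (by fun_prop) continuous_const

/-- Subgradients in terms of the epigraph. -/
theorem mem_subdiff_iff {θ : F → EReal} (hbot : ∀ z, θ z ≠ ⊥) {z v : F} :
    v ∈ subdiff θ z ↔ ∃ r : ℝ, θ z ≤ r ∧
      ∀ (w : F) (s : ℝ), θ w ≤ s → r + inner ℝ v (w - z) ≤ s := by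
  constructor
  · rintro ⟨htop, -, hv⟩
    obtain ⟨r, hr⟩ : ∃ r : ℝ, θ z = r := ⟨_, (EReal.coe_toReal htop (hbot z)).symm⟩
    refine ⟨r, hr.le, fun w s hs => ?_⟩
    have := (hv w).trans hs
    rw [hr] at this
    exact_mod_cast this
  · rintro ⟨r, hr, hv⟩
    refine ⟨fun h => by simp [h] at hr, hbot z, fun w => ?_⟩
    by_cases hw : θ w = ⊤
    · simp [hw]
    · obtain ⟨s, hs⟩ : ∃ s : ℝ, θ w = s := ⟨_, (EReal.coe_toReal hw (hbot w)).symm⟩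
      have h1 : r + inner ℝ v (w - z) ≤ s := hv w s hs.le
      calc θ z + ((inner ℝ v (w - z) : ℝ) : EReal)
          ≤ (r : EReal) + ((inner ℝ v (w - z) : ℝ) : EReal) := by gcongr
        _ ≤ θ w := by rw [hs]; exact_mod_cast h1

/-- A direction obeying the active constraints stays in the epigraph for a short step, as the
inactive ones have slack; conversely, differences of epigraph points with (z, r) obey the active
constraints. So ∂θ(z) depends only on the active index set. -/
theorem mem_subdiff_iff_faceSubdiff {θ : F → EReal} (hbot : ∀ z, θ z ≠ ⊥) {k : ℕ}
    {φ : Fin k → (F × ℝ →L[ℝ] ℝ)} {b : Fin k → ℝ}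
    (hepi : {q : F × ℝ | θ q.1 ≤ (q.2 : EReal)} = {q | ∀ i, φ i q ≤ b i}) {z v : F} :
    v ∈ subdiff θ z ↔ ∃ r : ℝ, θ z ≤ r ∧ v ∈ faceSubdiff φ {i | φ i (z, r) = b i} := by
  have hepi' : ∀ (w : F) (s : ℝ), θ w ≤ s ↔ ∀ i, φ i (w, s) ≤ b i := fun w s =>
    Set.ext_iff.1 hepi (w, s)
  rw [mem_subdiff_iff hbot]
  refine exists_congr fun r => and_congr_right fun hr => ⟨fun hv h τ hi => ?_, fun hv w s hs => ?_⟩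
  · have hev : ∀ᶠ t : ℝ in 𝓝[>] 0, ∀ i, φ i ((z, r) + t • (h, τ)) ≤ b i := by
      rw [eventually_all]
      intro i
      by_cases hact : φ i (z, r) = b i
      · filter_upwards [self_mem_nhdsWithin] with t ht
        have h1 := hi i (by simpa using hact)
        rw [map_add, map_smul, hact, smul_eq_mul]
        have := mul_nonpos_of_nonneg_of_nonpos (le_of_lt (show (0 : ℝ) < t from ht)) h1
        linarith
      · have hlt : φ i ((z, r) + (0 : ℝ) • (h, τ)) < b i := by
          simpa using lt_of_le_of_ne ((hepi' z r).1 hr i) hact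
        have hc : Continuous fun t : ℝ => φ i ((z, r) + t • (h, τ)) := by fun_prop
        have := (hc.tendsto 0).mono_left (nhdsWithin_le_nhds (s := Ioi 0))
        filter_upwards [this.eventually_lt_const hlt] with t ht using ht.le
    obtain ⟨t, ht, htpos⟩ := (hev.and self_mem_nhdsWithin).exists
    have htpos : 0 < t := htpos
    have h1 := hv (z + t • h) (r + t * τ) ((hepi' _ _).2 ht)
    rw [add_sub_cancel_left, inner_smul_right] at h1
    exact le_of_mul_le_mul_left (by linarith) htpos
  · have h1 := hv (w - z) (s - r) fun i hi => by
      have h2 : φ i (z, r) = b i := by simpa using hi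
      have h3 := (hepi' w s).1 hs i
      have h4 : (w - z, s - r) = (w, s) - (z, r) := rfl
      rw [h4, map_sub]
      linarith
    linarith

variable [FiniteDimensional ℝ F]

/-- Riesz representation of a functional on `F × ℝ`. -/
theorem exists_riesz_prod (l : F × ℝ →L[ℝ] ℝ) :
    ∃ (a : F) (c : ℝ), ∀ (h : F) (τ : ℝ), l (h, τ) = inner ℝ a h + c * τ := by
  have : CompleteSpace F := FiniteDimensional.complete ℝ F
  refine ⟨(InnerProductSpace.toDual ℝ F).symm (l.comp (ContinuousLinearMap.inl ℝ F ℝ)),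
    l (0, 1), fun h τ => ?_⟩
  rw [InnerProductSpace.toDual_symm_apply]
  have h1 : (h, τ) = (h, 0) + τ • ((0, 1) : F × ℝ) := by simp
  conv_lhs => rw [h1, map_add, map_smul]
  simp [mul_comm]

/-- By Farkas' lemma, the inequality defining the face is a nonnegative combination of the active
constraints. This puts faces in the form required by `exists_hoffman`. -/
theorem mem_faceSubdiff_iff {k : ℕ} {φ : Fin k → (F × ℝ →L[ℝ] ℝ)} {J : Finset (Fin k)}
    {g : Fin k → F × ℝ} (hg : ∀ i h τ, φ i (h, τ) = inner ℝ (g i).1 h + (g i).2 * τ) {v : F} :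
    v ∈ faceSubdiff φ J ↔ ∃ s : J → ℝ, 0 ≤ s ∧
      Fintype.linearCombination ℝ (fun i : J => g i) s = (v, -1) := by
  constructor
  · intro hv
    refine exists_nonneg_of_forall_functional _ _ fun l hl => ?_
    obtain ⟨a, c, hac⟩ := exists_riesz_prod l
    have h1 := hv a c fun i hi => by
      classical
      have h2 := hl (Pi.single ⟨i, hi⟩ 1) (Pi.single_nonneg.2 zero_le_one)
      rw [Fintype.linearCombination_apply_single, one_smul] at h2
      rw [hg]
      have h3 := hac (g i).1 (g i).2
      rw [real_inner_comm]
      simp only [Prod.mk.eta] at h3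
      linarith
    rw [hac, real_inner_comm]
    linarith
  · rintro ⟨s, hs, hsum⟩ h τ hi
    have h1 : ∑ i : J, s i * φ i (h, τ) = inner ℝ v h - τ := by
      rw [Fintype.linearCombination_apply] at hsum
      have hv : ∑ i : J, s i • (g i).1 = v := by
        simpa [Prod.fst_sum] using congrArg Prod.fst hsum
      have hc : ∑ i : J, s i * (g i).2 = -1 := by
        simpa [Prod.snd_sum] using congrArg Prod.snd hsum
      calc ∑ i : J, s i * φ i (h, τ)
          = ∑ i : J, (inner ℝ (s i • (g i).1) h + s i * (g i).2 * τ) :=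
            Finset.sum_congr rfl fun i _ => by
              rw [hg, real_inner_smul_left]
              ring
        _ = inner ℝ v h - τ := by
            rw [Finset.sum_add_distrib, ← sum_inner, ← Finset.sum_mul, hv, hc]
            ring
    have h2 : ∑ i : J, s i * φ i (h, τ) ≤ 0 :=
      Finset.sum_nonpos fun i _ => mul_nonpos_of_nonneg_of_nonpos (hs i) (hi i i.2)
    linarith

/-- The fibres of a linear map restricted to a face of the subdifferential depend in a Lipschitz
way on the value of the map. -/
theorem exists_faceSubdiff_hoffman {G : Type*} [NormedAddCommGroup G] [NormedSpace ℝ G] {k : ℕ}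
    (φ : Fin k → (F × ℝ →L[ℝ] ℝ)) (J : Finset (Fin k)) (A : F →L[ℝ] G) :
    ∃ c : ℝ, 0 ≤ c ∧ ∀ v ∈ faceSubdiff φ J, ∀ w ∈ faceSubdiff φ J,
      ∃ v' ∈ faceSubdiff φ J, A v' = A w ∧ ‖v' - v‖ ≤ c * ‖A w - A v‖ := by
  choose a c hac using fun i => exists_riesz_prod (φ i)
  have hmem := fun v : F => mem_faceSubdiff_iff (φ := φ) (J := J) (g := fun i => (a i, c i))
    (v := v) hac
  set M := Fintype.linearCombination ℝ (fun i : J => (a i, c i))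
  -- The identity on the last factor keeps that coordinate at -1, so the corrected multipliers still
  -- represent a point of the face.
  obtain ⟨K, hK0, hK⟩ := exists_hoffman
    (((A : F →ₗ[ℝ] G).prodMap (LinearMap.id : ℝ →ₗ[ℝ] ℝ)).comp M)
  refine ⟨‖LinearMap.toContinuousLinearMap M‖ * K, by positivity, fun v hv w hw => ?_⟩
  obtain ⟨s, hs, hMs⟩ := (hmem v).1 hv
  obtain ⟨t, ht, hMt⟩ := (hmem w).1 hw
  obtain ⟨s', hs', hMs', hle⟩ := hK s t hs ht
  simp only [LinearMap.comp_apply, hMs, hMt, LinearMap.prodMap_apply, LinearMap.id_apply,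
    Prod.mk_sub_mk, sub_self, ContinuousLinearMap.coe_coe] at hMs' hle
  rw [Prod.mk.injEq] at hMs'
  refine ⟨(M s').1, (hmem _).2 ⟨s', hs', Prod.ext rfl hMs'.2⟩, hMs'.1, ?_⟩
  have h1 : ‖M (s' - s)‖ ≤ ‖LinearMap.toContinuousLinearMap M‖ * ‖s' - s‖ :=
    (LinearMap.toContinuousLinearMap M).le_opNorm (s' - s)
  have h2 : ‖(M s').1 - v‖ ≤ ‖M (s' - s)‖ := by
    rw [map_sub, hMs]
    exact norm_fst_le (M s' - (v, -1))
  have h3 : ‖((A w - A v, 0) : G × ℝ)‖ = ‖A w - A v‖ := by simp [Prod.norm_def]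
  rw [h3] at hle
  calc ‖(M s').1 - v‖ ≤ ‖LinearMap.toContinuousLinearMap M‖ * ‖s' - s‖ := h2.trans h1
    _ ≤ ‖LinearMap.toContinuousLinearMap M‖ * (K * ‖A w - A v‖) := by gcongr
    _ = _ := by ring

/-- Along a subsequence, subgradients near a given subgradient stay in one face of the
subdifferential, which is common to all base points and to the limit point. -/
theorem IsCPWL.exists_subseq_face {θ : F → EReal} (hθ : IsCPWL θ) {z : ℕ → F} {v : ℕ → F}
    {zb vb : F} (hz : Tendsto z atTop (𝓝 zb)) (hv : Tendsto v atTop (𝓝 vb))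
    (hmem : ∀ k, v k ∈ subdiff θ (z k)) (hb : vb ∈ subdiff θ zb)
    {G : Type*} [NormedAddCommGroup G] [NormedSpace ℝ G] (A : F →L[ℝ] G) :
    ∃ (Q : Set F) (σ : ℕ → ℕ) (c : ℝ), StrictMono σ ∧ 0 ≤ c ∧ vb ∈ Q ∧ Q ⊆ subdiff θ zb ∧
      (∀ k, v (σ k) ∈ Q ∧ Q ⊆ subdiff θ (z (σ k))) ∧
      ∀ u ∈ Q, ∀ w ∈ Q, ∃ u' ∈ Q, A u' = A w ∧ ‖u' - u‖ ≤ c * ‖A w - A u‖ := by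
  obtain ⟨hbot, n, φ, b, hepi⟩ := hθ
  have hsub := fun z v => mem_subdiff_iff_faceSubdiff hbot hepi (z := z) (v := v)
  choose r hr hrJ using fun k => (hsub (z k) (v k)).1 (hmem k)
  obtain ⟨rb, hrb, hvb⟩ := (mem_subdiff_iff hbot).1 hb
  -- The heights are squeezed between the subgradient inequality of `vb` at `zb` and that of `v k`
  -- at `z k`.
  have hrlim : Tendsto r atTop (𝓝 rb) := by
    have h1 : ∀ k, rb + inner ℝ vb (z k - zb) ≤ r k := fun k => hvb _ _ (hr k)
    have h2 : ∀ k, r k ≤ rb - inner ℝ (v k) (zb - z k) := fun k => by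
      have hface := hrJ k
      have h3 := hface (zb - z k) (rb - r k) fun i hi => by
        have h4 : φ i (z k, r k) = b i := by simpa using hi
        have h5 : φ i (zb, rb) ≤ b i := (Set.ext_iff.1 hepi (zb, rb)).1 hrb i
        have h6 : (zb - z k, rb - r k) = (zb, rb) - (z k, r k) := rfl
        rw [h6, map_sub]
        linarith
      linarith
    refine tendsto_of_tendsto_of_tendsto_of_le_of_le ?_ ?_ h1 h2
    · simpa using (tendsto_const_nhds (x := rb)).add
        ((tendsto_const_nhds (x := vb)).inner (hz.sub_const zb) (𝕜 := ℝ))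
    · simpa using (tendsto_const_nhds (x := rb)).sub (hv.inner (hz.const_sub zb) (𝕜 := ℝ))
  -- Only finitely many active sets exist, so one occurs infinitely often.
  obtain ⟨J, hJ⟩ : ∃ J : Finset (Fin n), ∃ᶠ k in atTop, Finset.univ.filter
      (fun i => φ i (z k, r k) = b i) = J := by
    by_contra! hcon
    obtain ⟨k, hk⟩ := (eventually_all.2 hcon).exists
    exact hk _ rfl
  obtain ⟨σ, hσ, hσJ⟩ := extraction_of_frequently_atTop hJ
  obtain ⟨c, hc, hH⟩ := exists_faceSubdiff_hoffman φ J A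
  have hvJ : ∀ k, v (σ k) ∈ faceSubdiff φ J := fun k => hσJ k ▸ hrJ (σ k)
  refine ⟨faceSubdiff φ J, σ, c, hσ, hc, ?_, ?_, fun k => ⟨hvJ k, fun w hw => ?_⟩, hH⟩
  · exact (isClosed_faceSubdiff φ J).mem_of_tendsto (hv.comp hσ.tendsto_atTop)
      (Eventually.of_forall hvJ)
  · intro w hw
    -- Constraints active along the subsequence remain active at the limit, so the face can only
    -- grow.
    refine (hsub zb w).2 ⟨rb, hrb, faceSubdiff_mono φ (fun i hi => ?_) hw⟩
    have hlim : Tendsto (fun k => φ i (z (σ k), r (σ k))) atTop (𝓝 (φ i (zb, rb))) :=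
      ((φ i).continuous.tendsto _).comp
        ((hz.comp hσ.tendsto_atTop).prodMk_nhds (hrlim.comp hσ.tendsto_atTop))
    have hconst : ∀ k, φ i (z (σ k), r (σ k)) = b i := fun k => by
      have := hσJ k ▸ hi
      simpa using this
    simpa using tendsto_nhds_unique hlim (by simp [hconst])
  · exact (hsub _ w).2 ⟨r (σ k), hr _, (hσJ k).symm ▸ hw⟩

end Polyhedral

end VarSys

namespace VarSys

/-! ### The subdifferential of the Fenchel conjugate. -/

section Conjugate

variable {F : Type*} [NormedAddCommGroup F] [InnerProductSpace ℝ F]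

/-- The Fenchel conjugate is at most `M` iff `⟨v, ·⟩ - M` minorizes the function. -/
theorem fenchelConj_le_coe_iff {θ : F → EReal} (hbot : ∀ z, θ z ≠ ⊥) {v : F} {M : ℝ} :
    fenchelConj θ v ≤ M ↔ ∀ (z : F) (s : ℝ), θ z ≤ s → inner ℝ v z - s ≤ M := by
  rw [fenchelConj, iSup_le_iff]
  refine forall_congr' fun z => ⟨fun h s hs => ?_, fun h => ?_⟩
  · have h1 : ((inner ℝ v z : ℝ) : EReal) - (s : EReal) ≤ M :=
      (EReal.sub_le_sub le_rfl hs).trans h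
    exact_mod_cast h1
  · by_cases hz : θ z = ⊤
    · simp [hz]
    · obtain ⟨s, hs⟩ : ∃ s : ℝ, θ z = s := ⟨_, (EReal.coe_toReal hz (hbot z)).symm⟩
      rw [hs]
      exact_mod_cast h s hs.le

variable [FiniteDimensional ℝ F]

/-- For a polyhedral function, `∂θ* = (∂θ)⁻¹`. -/
theorem IsCPWL.mem_subdiff_fenchelConj_iff {θ : F → EReal} (hθ : IsCPWL θ) {z v : F}
    (hne : ∃ w, θ w ≠ ⊤) : z ∈ subdiff (fenchelConj θ) v ↔ v ∈ subdiff θ z := by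
  obtain ⟨hbot, n, φ, b, hepi⟩ := hθ
  have hepi' : ∀ (w : F) (s : ℝ), θ w ≤ s ↔ ∀ i, φ i (w, s) ≤ b i := fun w s =>
    Set.ext_iff.1 hepi (w, s)
  obtain ⟨w₀, hw₀⟩ := hne
  obtain ⟨s₀, hs₀⟩ : ∃ s : ℝ, θ w₀ = s := ⟨_, (EReal.coe_toReal hw₀ (hbot w₀)).symm⟩
  have hconj_bot : ∀ v, fenchelConj θ v ≠ ⊥ := fun v h => by
    have h1 : ((inner ℝ v w₀ : ℝ) : EReal) - θ w₀ ≤ fenchelConj θ v :=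
      le_iSup (fun z => ((inner ℝ v z : ℝ) : EReal) - θ z) w₀
    rw [h, hs₀, ← EReal.coe_sub] at h1
    exact EReal.coe_ne_bot _ (le_bot_iff.1 h1)
  rw [mem_subdiff_iff hbot, mem_subdiff_iff hconj_bot]
  constructor
  · rintro ⟨M, hM, hle⟩
    -- It must be shown that (z, ⟨v, z⟩ - M) lies in the epigraph. A violated constraint ⟨a, w⟩ + c
    -- s ≤ b contradicts the subgradient inequality of θ*, tested at a/(-c) if c < 0 and at v + a if
    -- c = 0.
    refine ⟨inner ℝ v z - M, ?_, fun w s hs => ?_⟩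
    · rw [hepi']
      intro i
      by_contra! hi
      obtain ⟨a, c, hac⟩ := exists_riesz_prod (φ i)
      rw [hac] at hi
      have hb : ∀ (w : F) (s : ℝ), θ w ≤ s → inner ℝ a w + c * s ≤ b i := fun w s hs => by
        rw [← hac]
        exact (hepi' w s).1 hs i
      have hc : c ≤ 0 := by
        by_contra! hc
        -- The epigraph is unbounded upwards; at this height a constraint with c > 0 would fail by
        -- at least 1.
        have h1 := hb w₀ (s₀ + (|b i - (inner ℝ a w₀ + c * s₀)| + 1) / c) (by
          rw [hs₀, EReal.coe_le_coe_iff]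
          have : 0 ≤ (|b i - (inner ℝ a w₀ + c * s₀)| + 1) / c := by positivity
          linarith)
        rw [mul_add, mul_div_cancel₀ _ hc.ne'] at h1
        linarith [le_abs_self (b i - (inner ℝ a w₀ + c * s₀))]
      have hMle := (fenchelConj_le_coe_iff hbot).1 hM
      rcases hc.lt_or_eq with hc | hc
      · have hcn : 0 < -c := by linarith
        have h1 := hle ((-c)⁻¹ • a) (b i / (-c)) ((fenchelConj_le_coe_iff hbot).2
          fun w s hs => by
            rw [real_inner_smul_left, inv_mul_eq_div, sub_le_iff_le_add, div_le_iff₀ hcn, add_mul,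
              div_mul_cancel₀ _ hcn.ne']
            linarith [hb w s hs])
        rw [inner_sub_right, inner_smul_right, inv_mul_eq_div, real_inner_comm, real_inner_comm v z,
          le_div_iff₀ hcn, add_mul, sub_mul, div_mul_cancel₀ _ hcn.ne'] at h1
        nlinarith
      · have h1 := hle (v + a) (M + b i) ((fenchelConj_le_coe_iff hbot).2 fun w s hs => by
          have h2 := hb w s hs
          have h3 := hMle w s hs
          rw [hc] at h2
          rw [inner_add_left]
          linarith)
        rw [add_sub_cancel_left, real_inner_comm] at h1
        rw [hc] at hi
        linarith
    · rw [inner_sub_right]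
      linarith [(fenchelConj_le_coe_iff hbot).1 hM w s hs]
  · rintro ⟨r, hr, hle⟩
    refine ⟨inner ℝ v z - r, (fenchelConj_le_coe_iff hbot).2 fun w s hs => ?_,
      fun w s hs => ?_⟩
    · have := hle w s hs
      rw [inner_sub_right] at this
      linarith
    · have := (fenchelConj_le_coe_iff hbot).1 hs z r hr
      rw [inner_sub_right]
      linarith [real_inner_comm w z, real_inner_comm v z]

end Conjugate

section Cone

/-! ### Tangent vectors as limits of difference quotients. -/

variable {X : Type*} [NormedAddCommGroup X] [NormedSpace ℝ X]

/-- Bouligand tangents are limits of difference quotients with positive steps. -/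
theorem exists_seq_of_mem_bouligandCone {Ω : Set X} {z w : X} (hz : z ∈ Ω)
    (hw : w ∈ bouligandCone Ω z) :
    ∃ (y : ℕ → X) (t : ℕ → ℝ), (∀ k, y k ∈ Ω) ∧ (∀ k, 0 < t k) ∧ Tendsto t atTop (𝓝 0) ∧
      Tendsto (fun k => (t k)⁻¹ • (y k - z)) atTop (𝓝 w) := by
  obtain ⟨y, α, hy, hα, hyz, hlim⟩ := hw
  -- For w = 0 the factors `α k` may vanish, so a constant sequence is used with arbitrary steps
  -- tending to 0.
  by_cases h0 : w = 0
  · refine ⟨fun _ => z, fun k => 1 / ((k : ℝ) + 1), fun _ => hz, fun k => by positivity,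
      tendsto_one_div_add_atTop_nhds_zero_nat, by simp [h0]⟩
  have hy0 : Tendsto (fun k => ‖y k - z‖) atTop (𝓝 0) := by
    simpa using (hyz.sub_const z).norm
  have hn : Tendsto (fun k => α k * ‖y k - z‖) atTop (𝓝 ‖w‖) := by
    simpa [norm_smul, abs_of_nonneg (hα _)] using hlim.norm
  have hwpos : 0 < ‖w‖ := norm_pos_iff.2 h0
  have hpos : ∀ᶠ k in atTop, 0 < α k := by
    filter_upwards [hn.eventually_const_lt hwpos] with k hk
    refine (hα k).lt_of_ne fun h => ?_
    rw [← h, zero_mul] at hk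
    exact lt_irrefl _ hk
  have hinv : Tendsto (fun k => (α k)⁻¹) atTop (𝓝 0) := by
    have h1 : Tendsto (fun k => ‖y k - z‖ / (α k * ‖y k - z‖)) atTop (𝓝 (0 / ‖w‖)) :=
      hy0.div hn hwpos.ne'
    rw [zero_div] at h1
    refine h1.congr' ?_
    filter_upwards [hn.eventually_const_lt hwpos] with k hk
    have h2 : ‖y k - z‖ ≠ 0 := fun h => by simp [h] at hk
    field_simp
  obtain ⟨N, hN⟩ := eventually_atTop.1 hpos
  refine ⟨fun k => y (k + N), fun k => (α (k + N))⁻¹, fun k => hy _,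
    fun k => inv_pos.2 (hN _ (Nat.le_add_left _ _)), hinv.comp (tendsto_add_atTop_nat N), ?_⟩
  simpa only [inv_inv, Function.comp_def] using hlim.comp (tendsto_add_atTop_nat N)

end Cone

/-! ### First-order expansion of Ψ. -/

section Expansion

variable {E F : Type*} [NormedAddCommGroup E] [InnerProductSpace ℝ E] [CompleteSpace E]
  [NormedAddCommGroup F] [InnerProductSpace ℝ F] [CompleteSpace F]

theorem norm_adjoint_sub_apply_le (G H : E →L[ℝ] F) (v : F) :
    ‖ContinuousLinearMap.adjoint G v - ContinuousLinearMap.adjoint H v‖ ≤ ‖G - H‖ * ‖v‖ := by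
  rw [← sub_apply, ← map_sub]
  exact ((ContinuousLinearMap.adjoint (G - H)).le_opNorm v).trans_eq (by
    rw [LinearIsometryEquiv.norm_map])

theorem differentiableAt_Psi {f : E → E} {Φ : E → F} {xb : E} (vb : F)
    (hf : DifferentiableAt ℝ f xb) (hΦ' : DifferentiableAt ℝ (fderiv ℝ Φ) xb) :
    DifferentiableAt ℝ (fun x => Psi f Φ x vb) xb := by
  let T : (E →L[ℝ] F) →L[ℝ] E := LinearMap.mkContinuous
    { toFun := fun G => ContinuousLinearMap.adjoint G vb
      map_add' := fun G H => by simp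
      map_smul' := fun c G => by simp } ‖vb‖ fun G => by
        have := norm_adjoint_sub_apply_le G 0 vb
        simpa [mul_comm] using this
  exact hf.add (T.differentiableAt.comp xb hΦ')

/-- First-order expansion of `Ψ` at a zero, jointly in both variables. -/
theorem Psi_isLittleO {f : E → E} {Φ : E → F} {xb : E} {vb : F}
    (hf : DifferentiableAt ℝ f xb) (hΦ' : DifferentiableAt ℝ (fderiv ℝ Φ) xb)
    (h0 : Psi f Φ xb vb = 0) :
    (fun q : E × F => Psi f Φ q.1 q.2 -
      (fderiv ℝ (fun x => Psi f Φ x vb) xb (q.1 - xb) +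
        ContinuousLinearMap.adjoint (fderiv ℝ Φ xb) (q.2 - vb)))
      =o[𝓝 (xb, vb)] fun q => q.1 - xb := by
  have hfst : Tendsto (Prod.fst : E × F → E) (𝓝 (xb, vb)) (𝓝 xb) := continuous_fst.tendsto _
  have hsnd : Tendsto (Prod.snd : E × F → F) (𝓝 (xb, vb)) (𝓝 vb) := continuous_snd.tendsto _
  -- Ψ is affine in v, so beyond the expansion of Ψ(·, v̄) only the cross term (∇Φ(x) - ∇Φ(x̄))*(v -
  -- v̄) remains, which is O(‖x - x̄‖) · o(1). Hence the remainder does not involve ‖v - v̄‖.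
  have h1 := (differentiableAt_Psi vb hf hΦ').hasFDerivAt.isLittleO.comp_tendsto hfst
  have h2 : (fun q : E × F => ContinuousLinearMap.adjoint (fderiv ℝ Φ q.1) (q.2 - vb) -
      ContinuousLinearMap.adjoint (fderiv ℝ Φ xb) (q.2 - vb)) =o[𝓝 (xb, vb)]
      fun q => q.1 - xb := by
    have h3 := hΦ'.isBigO_sub.comp_tendsto hfst
    have h4 : (fun q : E × F => q.2 - vb) =o[𝓝 (xb, vb)] (fun _ => (1 : ℝ)) := by
      rw [Asymptotics.isLittleO_one_iff]
      simpa using hsnd.sub_const vb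
    have h5 := h3.norm_norm.mul_isLittleO h4.norm_left
    refine (Asymptotics.IsBigO.of_bound 1 (Eventually.of_forall fun q => ?_)).trans_isLittleO
      (h5.trans_isBigO (Asymptotics.IsBigO.of_bound 1 (Eventually.of_forall fun q => ?_)))
    · simpa using norm_adjoint_sub_apply_le (fderiv ℝ Φ q.1) (fderiv ℝ Φ xb) (q.2 - vb)
    · simp
  refine (h1.add h2).congr_left fun q => ?_
  simp only [Function.comp, Psi] at h0 ⊢
  simp only [h0, map_sub]
  abel

end Expansion

end VarSys

namespace VarSys

/-! ### Calmness excludes criticality and is equivalent to the error bound. -/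

section Equivalences

/-- Nonemptiness matters: the real distance to ∅ is 0, the extended one ∞. -/
theorem enorm_add_infEDist_eq {E F : Type*} [NormedAddCommGroup E]
    [NormedAddCommGroup F] {S : Set F} (hS : S.Nonempty) (u : E) (v : F) :
    ‖u‖ₑ + Metric.infEDist v S = ENNReal.ofReal (‖u‖ + Metric.infDist v S) := by
  rw [ENNReal.ofReal_add (norm_nonneg _) Metric.infDist_nonneg, ofReal_norm, Metric.infDist,
    ENNReal.ofReal_toReal (Metric.infEDist_ne_top hS)]

variable {E F : Type*} [NormedAddCommGroup E] [InnerProductSpace ℝ E] [CompleteSpace E]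
  [NormedAddCommGroup F] [InnerProductSpace ℝ F] [CompleteSpace F]
  {f : E → E} {Φ : E → F} {θ : F → EReal} {xb : E} {vb : F}

theorem mem_solMap_iff {p₁ : E} {p₂ : F} {x : E} {v : F} :
    (x, v) ∈ solMap f Φ θ p₁ p₂ ↔ p₁ = Psi f Φ x v ∧ v ∈ subdiff θ (Φ x + p₂) := by
  refine and_congr_right fun _ => ⟨?_, fun h => ⟨_, h, by simp⟩⟩
  rintro ⟨z, hz, rfl : p₂ = _⟩
  simpa using hz

/-- Semi-isolated calmness excludes critical multipliers. -/
theorem SemiIsolatedCalm.not_isCritical (h : SemiIsolatedCalm f Φ θ xb vb)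
    (hf : DifferentiableAt ℝ f xb) (hΦ : DifferentiableAt ℝ Φ xb)
    (hΦ' : DifferentiableAt ℝ (fderiv ℝ Φ) xb) (hvb : vb ∈ multipliers f Φ θ xb) :
    ¬ IsCritical f Φ θ xb vb := by
  -- Pair x̄ + t_k ξ with the multipliers of a sequence realizing the tangent (∇Φ(x̄)ξ, η). Both
  -- residuals are o(t_k), while the primal distance is t_k‖ξ‖.
  rintro ⟨ξ, hξ, η, hη, hcrit⟩
  obtain ⟨ε, hε, ℓ, hℓ, U, hU, W, hW, hcalm⟩ := h
  obtain ⟨y, t, hy, ht, ht0, hlim⟩ := exists_seq_of_mem_bouligandCone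
    (show (Φ xb, vb) ∈ gph (subdiff θ) from hvb.2) hη
  set x : ℕ → E := fun k => xb + t k • ξ with hx
  have hxlim : Tendsto x atTop (𝓝 xb) := by
    simpa using (tendsto_const_nhds (x := xb)).add (ht0.smul_const ξ)
  have hxO : (fun k => x k - xb) =O[atTop] t :=
    Asymptotics.IsBigO.of_bound ‖ξ‖ (Eventually.of_forall fun k => by
      simp [hx, norm_smul, mul_comm])
  have hxt : ∀ k, (t k)⁻¹ • (x k - xb) = ξ := fun k => by
    simp [hx, smul_smul, inv_mul_cancel₀ (ht k).ne']
  have hz : Tendsto (fun k => (t k)⁻¹ • ((y k).1 - Φ xb)) atTop (𝓝 (fderiv ℝ Φ xb ξ)) :=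
    (continuous_fst.tendsto _).comp hlim
  have hv : Tendsto (fun k => (t k)⁻¹ • ((y k).2 - vb)) atTop (𝓝 η) :=
    (continuous_snd.tendsto _).comp hlim
  have hvlim : Tendsto (fun k => (y k).2) atTop (𝓝 vb) := by
    have h1 := (ht0.smul hv).add_const vb
    simpa [smul_smul, mul_inv_cancel₀ (ht _).ne'] using h1
  have hp1 : Tendsto (fun k => (t k)⁻¹ • Psi f Φ (x k) (y k).2) atTop (𝓝 0) := by
    have h1 := ((Psi_isLittleO hf hΦ' hvb.1).comp_tendsto
      (hxlim.prodMk_nhds hvlim)).trans_isBigO hxO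
    have h2 := h1.tendsto_inv_smul_nhds_zero.add (((tendsto_const_nhds
      (x := fderiv ℝ (fun x' => Psi f Φ x' vb) xb ξ))).add
        (((ContinuousLinearMap.adjoint (fderiv ℝ Φ xb)).continuous.tendsto η).comp hv))
    rw [hcrit, add_zero] at h2
    refine h2.congr fun k => ?_
    nth_rw 1 [← hxt k]
    simp only [Function.comp, map_smul, ← smul_add, sub_add_cancel]
  have hp2 : Tendsto (fun k => (t k)⁻¹ • (-Φ (x k) + (y k).1)) atTop (𝓝 0) := by
    have h1 := (hΦ.hasFDerivAt.isLittleO.comp_tendsto hxlim).trans_isBigO hxO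
    have h2 := (hz.sub_const (fderiv ℝ Φ xb ξ)).sub h1.tendsto_inv_smul_nhds_zero
    rw [sub_self, sub_zero] at h2
    refine h2.congr fun k => ?_
    nth_rw 1 [← hxt k]
    simp only [Function.comp, map_smul, ← smul_sub]
    congr 1
    abel
  have hp1' : Tendsto (fun k => Psi f Φ (x k) (y k).2) atTop (𝓝 0) := by
    simpa [smul_smul, mul_inv_cancel₀ (ht _).ne'] using ht0.smul hp1
  have hp2' : Tendsto (fun k => -Φ (x k) + (y k).1) atTop (𝓝 0) := by
    simpa [-smul_add, smul_smul, mul_inv_cancel₀ (ht _).ne'] using ht0.smul hp2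
  have hle : ∀ᶠ k in atTop, ‖ξ‖ ≤ ℓ * (‖(t k)⁻¹ • Psi f Φ (x k) (y k).2‖ +
      ‖(t k)⁻¹ • (-Φ (x k) + (y k).1)‖) := by
    filter_upwards [hp1'.eventually_mem hU, hp2'.eventually_mem hW,
      (hxlim.prodMk_nhds hvlim).eventually_mem (Metric.closedBall_mem_nhds _ hε)] with k h1 h2 h3
    have h4 := hcalm _ h1 _ h2 (x k) (y k).2 ⟨⟨rfl, _, hy k, rfl⟩, h3⟩
    have h5 : 0 ≤ Metric.infDist (y k).2 (multipliers f Φ θ xb) := Metric.infDist_nonneg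
    have h6 : 0 < (t k)⁻¹ := inv_pos.2 (ht k)
    calc ‖ξ‖ = (t k)⁻¹ * ‖x k - xb‖ := by
          rw [← hxt k, norm_smul, Real.norm_of_nonneg h6.le]
      _ ≤ (t k)⁻¹ * (ℓ * (‖Psi f Φ (x k) (y k).2‖ + ‖-Φ (x k) + (y k).1‖)) := by
          gcongr
          linarith
      _ = _ := by
          rw [norm_smul, norm_smul, Real.norm_of_nonneg h6.le]
          ring
  have hlim0 := ge_of_tendsto ((hp1.norm.add hp2.norm).const_mul ℓ) hle
  simp only [norm_zero, add_zero, mul_zero] at hlim0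
  exact hξ (norm_le_zero_iff.1 hlim0)

/-- For a solution, Φ(x) + p₂ belongs to ∂θ*(v), so the distance in the error bound is at most ‖p₂‖;
no smallness of the perturbation is needed. -/
theorem ErrorBound.semiIsolatedCalm [FiniteDimensional ℝ F] (h : ErrorBound f Φ θ xb vb)
    (hθ : IsCPWL θ) (hvb : vb ∈ multipliers f Φ θ xb) : SemiIsolatedCalm f Φ θ xb vb := by
  obtain ⟨ε, hε, ℓ, hle⟩ := h
  refine ⟨ε, hε, ℓ, ℓ.2, univ, univ_mem, univ, univ_mem, fun p₁ _ p₂ _ x v ⟨hS, hball⟩ => ?_⟩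
  obtain ⟨rfl, hv⟩ := mem_solMap_iff.1 hS
  have h1 := hle x v hball
  have h2 : Metric.infEDist (Φ x) (subdiff (fenchelConj θ) v) ≤ ‖p₂‖ₑ := by
    have h3 := Metric.infEDist_le_edist_of_mem (x := Φ x)
      ((hθ.mem_subdiff_fenchelConj_iff ⟨_, hvb.2.1⟩).2 hv)
    rwa [edist_comm, edist_eq_enorm_sub, add_sub_cancel_left] at h3
  have h3 := h1.trans (mul_le_mul_right (add_le_add_right h2 _) _)
  rw [enorm_add_infEDist_eq ⟨vb, hvb⟩, ← ofReal_norm, ← ofReal_norm,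
    ← ENNReal.ofReal_add (norm_nonneg _) (norm_nonneg _), ← ENNReal.ofReal_coe_nnreal,
    ← ENNReal.ofReal_mul ℓ.coe_nonneg] at h3
  exact (ENNReal.ofReal_le_ofReal_iff (by positivity)).1 h3

/-- Each z ∈ ∂θ*(v) makes (x, v) a solution for the perturbation (Ψ(x, v), z - Φ(x)). If this is
small, calmness applies; otherwise the residual is at least r while the left side is at most 2ε,
whence the term 2ε/r in the constant. -/
theorem SemiIsolatedCalm.errorBound [FiniteDimensional ℝ F] (h : SemiIsolatedCalm f Φ θ xb vb)
    (hθ : IsCPWL θ) (hvb : vb ∈ multipliers f Φ θ xb) : ErrorBound f Φ θ xb vb := by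
  obtain ⟨ε, hε, ℓ, hℓ, U, hU, W, hW, hcalm⟩ := h
  obtain ⟨r₁, hr₁, hU⟩ := Metric.mem_nhds_iff.1 hU
  obtain ⟨r₂, hr₂, hW⟩ := Metric.mem_nhds_iff.1 hW
  obtain ⟨r, hr, hr1, hr2⟩ : ∃ r, 0 < r ∧ r ≤ r₁ ∧ r ≤ r₂ :=
    ⟨min r₁ r₂, lt_min hr₁ hr₂, min_le_left _ _, min_le_right _ _⟩
  have hL : 0 < ℓ + 2 * ε / r := by positivity
  have key : ∀ x v, (x, v) ∈ Metric.closedBall (xb, vb) ε → ∀ z, v ∈ subdiff θ z →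
      ‖x - xb‖ + Metric.infDist v (multipliers f Φ θ xb) ≤
        (ℓ + 2 * ε / r) * (‖Psi f Φ x v‖ + ‖z - Φ x‖) := by
    intro x v hball z hz
    have hsol : (x, v) ∈ solMap f Φ θ (Psi f Φ x v) (z - Φ x) :=
      mem_solMap_iff.2 ⟨rfl, by simpa using hz⟩
    have hP : 0 ≤ ‖Psi f Φ x v‖ + ‖z - Φ x‖ := by positivity
    by_cases hsmall : ‖Psi f Φ x v‖ < r ∧ ‖z - Φ x‖ < r
    · refine (hcalm _ (hU ?_) _ (hW ?_) x v ⟨hsol, hball⟩).trans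
        (mul_le_mul_of_nonneg_right (le_add_of_nonneg_right (by positivity)) hP)
      · simpa using hsmall.1.trans_le hr1
      · simpa using hsmall.2.trans_le hr2
    · have hbig : r ≤ ‖Psi f Φ x v‖ + ‖z - Φ x‖ := by
        by_contra! hlt
        exact hsmall ⟨by linarith [norm_nonneg (z - Φ x)],
          by linarith [norm_nonneg (Psi f Φ x v)]⟩
      rw [Metric.mem_closedBall, Prod.dist_eq, max_le_iff, dist_eq_norm] at hball
      have h1 := (Metric.infDist_le_dist_of_mem hvb).trans hball.2
      have h2 : 2 * ε ≤ 2 * ε / r * (‖Psi f Φ x v‖ + ‖z - Φ x‖) := by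
        rw [div_mul_eq_mul_div, le_div_iff₀ hr]
        gcongr
      have h3 := mul_nonneg hℓ hP
      linarith [hball.1]
  refine ⟨ε, hε, ⟨ℓ + 2 * ε / r, hL.le⟩, fun x v hball => ?_⟩
  set L : NNReal := ⟨ℓ + 2 * ε / r, hL.le⟩
  have hL0 : (L : ENNReal) ≠ 0 := ENNReal.coe_ne_zero.2 fun h => hL.ne' (congrArg NNReal.toReal h)
  -- Isolating the distance reduces the claim to a bound for each z separately, which also covers an
  -- empty ∂θ*(v).
  rw [← ENNReal.div_le_iff' hL0 ENNReal.coe_ne_top, ← tsub_le_iff_left, Metric.le_infEDist]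
  intro z hz
  rw [hθ.mem_subdiff_fenchelConj_iff ⟨_, hvb.2.1⟩] at hz
  rw [tsub_le_iff_left, ENNReal.div_le_iff' hL0 ENNReal.coe_ne_top, edist_comm,
    edist_eq_enorm_sub, enorm_add_infEDist_eq ⟨vb, hvb⟩, ← ofReal_norm, ← ofReal_norm,
    ← ENNReal.ofReal_add (norm_nonneg _) (norm_nonneg _), ← ENNReal.ofReal_coe_nnreal,
    ← ENNReal.ofReal_mul L.coe_nonneg]
  exact ENNReal.ofReal_le_ofReal (key x v hball z hz)

end Equivalences

end VarSys

namespace VarSys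

/-! ### Noncriticality implies calmness. -/

section Noncritical

variable {E F : Type*} [NormedAddCommGroup E] [InnerProductSpace ℝ E] [FiniteDimensional ℝ E]
  [CompleteSpace E] [NormedAddCommGroup F] [InnerProductSpace ℝ F] [FiniteDimensional ℝ F]
  [CompleteSpace F] {f : E → E} {Φ : E → F} {θ : F → EReal} {xb : E} {vb : F}

/-- If solutions of perturbed systems converge with residuals negligible against the primal
distance, and the multipliers lie in a set on which the fibres of `∇Φ(xb)*` are Lipschitz, then
the limit multiplier is critical. -/
theorem isCritical_of_tendsto (hf : DifferentiableAt ℝ f xb) (hΦ : DifferentiableAt ℝ Φ xb)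
    (hΦ' : DifferentiableAt ℝ (fderiv ℝ Φ) xb) (h0 : Psi f Φ xb vb = 0)
    {x : ℕ → E} {v p₂ : ℕ → F} (hx : Tendsto x atTop (𝓝 xb)) (hv : Tendsto v atTop (𝓝 vb))
    (hne : ∀ᶠ k in atTop, x k ≠ xb)
    (hp₁ : (fun k => Psi f Φ (x k) (v k)) =o[atTop] fun k => ‖x k - xb‖)
    (hp₂ : p₂ =o[atTop] fun k => ‖x k - xb‖)
    (hp₂' : Tendsto p₂ atTop (𝓝 0))
    {Q : Set F} {c B : ℝ} (hc : 0 ≤ c) (hvb : vb ∈ Q)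
    (hQ : ∀ k, v k ∈ Q ∧ Q ⊆ subdiff θ (Φ (x k) + p₂ k))
    (hLip : ∀ u ∈ Q, ∀ w ∈ Q, ∃ u' ∈ Q, ContinuousLinearMap.adjoint (fderiv ℝ Φ xb) u' =
      ContinuousLinearMap.adjoint (fderiv ℝ Φ xb) w ∧
      ‖u' - u‖ ≤ c * ‖ContinuousLinearMap.adjoint (fderiv ℝ Φ xb) w -
        ContinuousLinearMap.adjoint (fderiv ℝ Φ xb) u‖)
    (hA : ∀ᶠ k in atTop, ‖ContinuousLinearMap.adjoint (fderiv ℝ Φ xb) (v k) -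
        ContinuousLinearMap.adjoint (fderiv ℝ Φ xb) vb‖ ≤ B * ‖x k - xb‖) :
    IsCritical f Φ θ xb vb := by
  set A := ContinuousLinearMap.adjoint (fderiv ℝ Φ xb)
  set L := fderiv ℝ (fun x => Psi f Φ x vb) xb
  -- The quotients of `v k - vb` need not be bounded; those of `v' k - vb` are, with unchanged image
  -- under `A`.
  choose v' hv'Q hAv' hv'le using fun k => hLip vb hvb (v k) (hQ k).1
  have hv' : Tendsto v' atTop (𝓝 vb) := by
    rw [tendsto_iff_norm_sub_tendsto_zero]
    have h1 : Tendsto (fun k => c * ‖A (v k) - A vb‖) atTop (𝓝 0) := by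
      simpa using ((((A.continuous.tendsto vb).comp hv).sub_const (A vb)).norm).const_mul c
    exact squeeze_zero (fun _ => norm_nonneg _) hv'le h1
  set s : ℕ → ℝ := fun k => ‖x k - xb‖
  have hspos : ∀ᶠ k in atTop, 0 < s k := by
    filter_upwards [hne] with k hk using norm_pos_iff.2 (sub_ne_zero.2 hk)
  set q : ℕ → E × F := fun k => ((s k)⁻¹ • (x k - xb), (s k)⁻¹ • (v' k - vb))
  have hnorm1 : ∀ k, 0 < s k → ‖(q k).1‖ = 1 := fun k hk => by
    show ‖(s k)⁻¹ • (x k - xb)‖ = 1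
    rw [norm_smul, norm_inv, Real.norm_of_nonneg hk.le]
    exact inv_mul_cancel₀ hk.ne'
  have hbd : ∀ᶠ k in atTop, q k ∈ Metric.closedBall (0 : E × F) (max 1 (c * B)) := by
    filter_upwards [hspos, hA] with k hk hAk
    rw [mem_closedBall_zero_iff, Prod.norm_def]
    refine max_le_max (hnorm1 k hk).le ?_
    show ‖(s k)⁻¹ • (v' k - vb)‖ ≤ c * B
    rw [norm_smul, norm_inv, Real.norm_of_nonneg hk.le, inv_mul_eq_div, div_le_iff₀ hk, mul_assoc]
    exact (hv'le k).trans (mul_le_mul_of_nonneg_left hAk hc)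
  obtain ⟨⟨ξ, η⟩, -, τ, hτ, hlim⟩ := (isCompact_closedBall _ _).tendsto_subseq' hbd.frequently
  have hτt := hτ.tendsto_atTop
  have hξ : Tendsto (fun k => (s (τ k))⁻¹ • (x (τ k) - xb)) atTop (𝓝 ξ) :=
    (continuous_fst.tendsto _).comp hlim
  have hη : Tendsto (fun k => (s (τ k))⁻¹ • (v' (τ k) - vb)) atTop (𝓝 η) :=
    (continuous_snd.tendsto _).comp hlim
  refine ⟨ξ, fun hξ0 => ?_, η, ⟨fun k => (Φ (x (τ k)) + p₂ (τ k), v' (τ k)),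
    fun k => (s (τ k))⁻¹, fun k => (hQ _).2 (hv'Q _), fun k => by positivity, ?_, ?_⟩, ?_⟩
  · have h1 : Tendsto (fun k => ‖(s (τ k))⁻¹ • (x (τ k) - xb)‖) atTop (𝓝 1) :=
      tendsto_const_nhds.congr' ((hτt.eventually hspos).mono fun k hk => (hnorm1 _ hk).symm)
    have h2 := tendsto_nhds_unique hξ.norm h1
    simp [hξ0] at h2
  · refine Tendsto.prodMk_nhds ?_ (hv'.comp hτt)
    simpa [Function.comp_def] using ((hΦ.continuousAt.tendsto.comp hx).add hp₂').comp hτt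
  · refine Tendsto.prodMk_nhds ?_ hη
    have h1 := ((hΦ.hasFDerivAt.isLittleO.comp_tendsto hx).norm_right.add
      hp₂).tendsto_inv_smul_nhds_zero.comp hτt
    have h2 := h1.add (((fderiv ℝ Φ xb).continuous.tendsto ξ).comp hξ)
    rw [zero_add] at h2
    refine h2.congr fun k => ?_
    simp only [Function.comp, map_smul, ← smul_add, Prod.fst_sub, s]
    congr 1
    abel
  -- Subtracting the o(‖x - x̄‖) remainder from the residual leaves the linear part, so its quotient
  -- tends to 0; replacing `v` by `v'` does not alter it.
  · have h1 := (hp₁.sub ((Psi_isLittleO hf hΦ' h0).comp_tendsto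
      (hx.prodMk_nhds hv)).norm_right).tendsto_inv_smul_nhds_zero.comp hτt
    have h2 := ((L.continuous.tendsto ξ).comp hξ).add ((A.continuous.tendsto η).comp hη)
    refine tendsto_nhds_unique h2 (h1.congr fun k => ?_)
    simp only [Function.comp, map_smul, map_sub, hAv', ← smul_add, s, sub_sub_cancel, A, L]

/-- A noncritical multiplier yields semi-isolated calmness. -/
theorem semiIsolatedCalm_of_not_isCritical (hθ : IsCPWL θ) (hf : DifferentiableAt ℝ f xb)
    (hΦ : DifferentiableAt ℝ Φ xb) (hΦ' : DifferentiableAt ℝ (fderiv ℝ Φ) xb)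
    (hvb : vb ∈ multipliers f Φ θ xb) (hcrit : ¬ IsCritical f Φ θ xb vb) :
    SemiIsolatedCalm f Φ θ xb vb := by
  by_contra hnot
  -- Calmness is negated with radius 1/(k+1) and constant k; p₁ needs no restriction, being
  -- determined by (x, v).
  have hseq : ∀ k : ℕ, ∃ (p₂ : F) (x : E) (v : F), ‖p₂‖ ≤ 1 / ((k : ℝ) + 1) ∧
      v ∈ subdiff θ (Φ x + p₂) ∧ (x, v) ∈ Metric.closedBall (xb, vb) (1 / ((k : ℝ) + 1)) ∧
      k * (‖Psi f Φ x v‖ + ‖p₂‖) < ‖x - xb‖ + Metric.infDist v (multipliers f Φ θ xb) := by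
    intro k
    by_contra! hcon
    refine hnot ⟨1 / ((k : ℝ) + 1), by positivity, k, by positivity, univ, univ_mem,
      Metric.closedBall 0 (1 / ((k : ℝ) + 1)), Metric.closedBall_mem_nhds _ (by positivity),
      fun p₁ _ p₂ hp₂ x v ⟨hS, hball⟩ => ?_⟩
    obtain ⟨rfl, hv⟩ := mem_solMap_iff.1 hS
    exact hcon p₂ x v (by simpa using hp₂) hv hball
  choose p₂ x v hp₂le hsub hball hlt using hseq
  have hε : Tendsto (fun k : ℕ => 1 / ((k : ℝ) + 1)) atTop (𝓝 0) :=
    tendsto_one_div_add_atTop_nhds_zero_nat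
  have hp₂ : Tendsto p₂ atTop (𝓝 0) := squeeze_zero_norm hp₂le hε
  have hxv : Tendsto (fun k => (x k, v k)) atTop (𝓝 (xb, vb)) :=
    tendsto_iff_dist_tendsto_zero.2 (squeeze_zero (fun _ => dist_nonneg) hball hε)
  have hx : Tendsto x atTop (𝓝 xb) := (continuous_fst.tendsto _).comp hxv
  have hv : Tendsto v atTop (𝓝 vb) := (continuous_snd.tendsto _).comp hxv
  have hz : Tendsto (fun k => Φ (x k) + p₂ k) atTop (𝓝 (Φ xb)) := by
    simpa using (hΦ.continuousAt.tendsto.comp hx).add hp₂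
  obtain ⟨Q, σ, c, hσ, hc, hvbQ, hQb, hQ, hLip⟩ := hθ.exists_subseq_face hz hv hsub hvb.2
    (ContinuousLinearMap.adjoint (fderiv ℝ Φ xb))
  have hσt := hσ.tendsto_atTop
  set A := ContinuousLinearMap.adjoint (fderiv ℝ Φ xb) with hAdef
  set L := fderiv ℝ (fun x => Psi f Φ x vb) xb
  set P : ℕ → ℝ := fun k => ‖Psi f Φ (x (σ k)) (v (σ k))‖ + ‖p₂ (σ k)‖ with hP
  set s : ℕ → ℝ := fun k => ‖x (σ k) - xb‖ with hs
  have hP0 : ∀ k, 0 ≤ P k := fun k => by positivity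
  have hs0 : ∀ k, 0 ≤ s k := fun k => norm_nonneg _
  have hA : ∀ᶠ k in atTop, ‖A (v (σ k)) - A vb‖ ≤ P k + (‖L‖ + 1) * s k := by
    have h1 := ((Psi_isLittleO hf hΦ' hvb.1).comp_tendsto (hxv.comp hσt)).bound one_pos
    filter_upwards [h1] with k hk
    simp only [Function.comp, one_mul] at hk
    have h2 : A (v (σ k)) - A vb = Psi f Φ (x (σ k)) (v (σ k)) - L (x (σ k) - xb) -
        (Psi f Φ (x (σ k)) (v (σ k)) - (L (x (σ k) - xb) + A (v (σ k) - vb))) := by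
      rw [map_sub A]
      abel
    have h3 := L.le_opNorm (x (σ k) - xb)
    calc ‖A (v (σ k)) - A vb‖ ≤ ‖Psi f Φ (x (σ k)) (v (σ k))‖ + ‖L (x (σ k) - xb)‖ +
          ‖Psi f Φ (x (σ k)) (v (σ k)) - (L (x (σ k) - xb) + A (v (σ k) - vb))‖ := by
          rw [h2]
          exact (norm_sub_le _ _).trans (add_le_add_left (norm_sub_le _ _) _)
      _ ≤ P k + (‖L‖ + 1) * s k := by
          simp only [hP, hs]
          linarith [norm_nonneg (p₂ (σ k))]
  have hdist : ∀ k, Metric.infDist (v (σ k)) (multipliers f Φ θ xb) ≤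
      c * ‖A (v (σ k)) - A vb‖ := fun k => by
    -- Moving v within Q to the fibre of `A` through `vb` lands in Λ(x̄), because Q ⊆ ∂θ(Φ(x̄)).
    obtain ⟨w, hwQ, hAw, hw⟩ := hLip _ (hQ k).1 vb hvbQ
    have hwΛ : w ∈ multipliers f Φ θ xb := ⟨by
      have h1 := hvb.1
      simp only [Psi, ← hAdef] at h1 ⊢
      rw [hAw, h1], hQb hwQ⟩
    have h1 := Metric.infDist_le_dist_of_mem (x := v (σ k)) hwΛ
    rw [dist_comm, dist_eq_norm] at h1
    rw [norm_sub_rev (A (v (σ k)))]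
    exact h1.trans hw
  set C := 1 + c * (‖L‖ + 1) with hC
  have hCpos : 0 < C := by positivity
  -- Inserting the bound on dist(v; Λ) lets the term `c * P k` be absorbed on the left, with `σ k ≥
  -- k`.
  have hPs : ∀ᶠ k : ℕ in atTop, ((k : ℝ) - c) * P k < C * s k := by
    filter_upwards [hA] with k hk
    have h1 := hlt (σ k)
    have h2 : (k : ℝ) * P k ≤ (σ k : ℝ) * P k :=
      mul_le_mul_of_nonneg_right (by exact_mod_cast hσ.id_le k) (hP0 k)
    have h3 := mul_le_mul_of_nonneg_left hk hc
    have h4 := hdist k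
    simp only [hC]
    have h5 : (σ k : ℝ) * P k < s k + Metric.infDist (v (σ k)) (multipliers f Φ θ xb) := h1
    linarith
  have hnat : Tendsto (fun k : ℕ => (k : ℝ)) atTop atTop := tendsto_natCast_atTop_atTop
  have hPo : P =o[atTop] s := by
    refine Asymptotics.IsLittleO.of_bound fun δ hδ => ?_
    filter_upwards [hPs, hnat.eventually_ge_atTop (c + C / δ)] with k hk hkbig
    rw [Real.norm_of_nonneg (hP0 k), Real.norm_of_nonneg (hs0 k)]
    have h1 : C / δ * P k ≤ C * s k :=
      (mul_le_mul_of_nonneg_right (by linarith) (hP0 k)).trans hk.le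
    rw [div_mul_eq_mul_div, div_le_iff₀ hδ] at h1
    exact le_of_mul_le_mul_left (by linarith) hCpos
  have hne : ∀ᶠ k in atTop, x (σ k) ≠ xb := by
    filter_upwards [hPs, hnat.eventually_ge_atTop c] with k hk hkc heq
    have h1 : s k = 0 := by simp [hs, heq]
    rw [h1, mul_zero] at hk
    exact absurd hk (not_lt.2 (mul_nonneg (by linarith) (hP0 k)))
  -- The value of `B` comes from `hA` together with P ≤ s eventually.
  refine hcrit (isCritical_of_tendsto hf hΦ hΦ' hvb.1 (hx.comp hσt) (hv.comp hσt) hne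
    (p₂ := p₂ ∘ σ) (B := ‖L‖ + 2) ?_ ?_ (hp₂.comp hσt) hc hvbQ hQ hLip ?_)
  · refine (Asymptotics.IsBigO.of_bound 1 (Eventually.of_forall fun k => ?_)).trans_isLittleO hPo
    rw [one_mul, Real.norm_of_nonneg (hP0 k)]
    exact le_add_of_nonneg_right (norm_nonneg _)
  · refine (Asymptotics.IsBigO.of_bound 1 (Eventually.of_forall fun k => ?_)).trans_isLittleO hPo
    rw [one_mul, Real.norm_of_nonneg (hP0 k)]
    exact le_add_of_nonneg_left (norm_nonneg _)
  · filter_upwards [hA, hPo.bound one_pos] with k hk hk'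
    rw [one_mul, Real.norm_of_nonneg (hP0 k), Real.norm_of_nonneg (hs0 k)] at hk'
    refine hk.trans ?_
    show P k + (‖L‖ + 1) * s k ≤ (‖L‖ + 2) * s k
    linarith

end Noncritical

end VarSys

theorem theorem4p1 {n m : ℕ}
    (f : EuclideanSpace ℝ (Fin n) → EuclideanSpace ℝ (Fin n))
    (Φ : EuclideanSpace ℝ (Fin n) → EuclideanSpace ℝ (Fin m))
    (θ : EuclideanSpace ℝ (Fin m) → EReal) (hθ : VarSys.IsCPWL θ)
    (xb : EuclideanSpace ℝ (Fin n)) (vb : EuclideanSpace ℝ (Fin m))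
    (hf : DifferentiableAt ℝ f xb)
    (hΦ : Differentiable ℝ Φ) (hΦ' : DifferentiableAt ℝ (fderiv ℝ Φ) xb)
    (hsol : (xb, vb) ∈ VarSys.solMap f Φ θ 0 0) :
    List.TFAE [¬ VarSys.IsCritical f Φ θ xb vb,
      VarSys.SemiIsolatedCalm f Φ θ xb vb,
      VarSys.ErrorBound f Φ θ xb vb] := by
  obtain ⟨h0, hv⟩ := VarSys.mem_solMap_iff.1 hsol
  have hvb : vb ∈ VarSys.multipliers f Φ θ xb := ⟨h0.symm, by simpa using hv⟩
  tfae_have 1 → 2 := VarSys.semiIsolatedCalm_of_not_isCritical hθ hf (hΦ xb) hΦ' hvb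
  tfae_have 2 → 1 := fun h => h.not_isCritical hf (hΦ xb) hΦ' hvb
  tfae_have 2 → 3 := fun h => h.errorBound hθ hvb
  tfae_have 3 → 2 := fun h => h.semiIsolatedCalm hθ hvb
  tfae_finish
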